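/- Let $\mathcal S=\mathcal S(\mathbb R)$ be the space of complex-valued Schwartz functions and $\mathcal S'$ the space of tempered distributions with the topology of pointwise convergence on $\mathcal S$. For $\varphi\in\mathcal S$ put $\hat\varphi(k)=\int_{\mathbb R}\varphi(x)e^{-ikx}\,dx$, and for $u\in\mathcal S'$ define $\hat u\in\mathcal S'$ by $\langle\hat u,\varphi\rangle=\langle u,\hat\varphi\rangle$ and $u(-\,\cdot)$ by $\langle u(-\,\cdot),\varphi\rangle=\langle u,\varphi(-\,\cdot)\rangle$. A bounded measurable function $f$ is identified with the tempered distribution $\varphi\mapsto\int_{\mathbb R} f\varphi\,dx$. For a function $f$ with a singularity at the origin, $\operatorname{p.v.}f$ denotes the tempered distribution $\varphi\mapsto\lim_{\varepsilon\to0^+}\int_{|x|>\varepsilon}f(x)\varphi(x)\,dx$, when these integrals converge absolutely and the limit exists for every $\varphi\in\mathcal S$ and depends continuously on $\varphi$. Let $\delta$ be the Dirac distribution at $0$ and $\Theta$ the Heaviside function ($\Theta(x)=1$ for $x>0$ and $\Theta(x)=0$ for $x<0$). 1. For every $\beta>0$ the distribution $\operatorname{p.v.}\frac{1}{\sinh(\pi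 k/\beta)}$ exists, and the Fourier transform of the Fermi–Dirac function $F_{\mathrm{FD},\beta}(x)=\frac{1}{e^{\beta x}+1}$ is $$\hat F_{\mathrm{FD},\beta}=\pi\,\delta(k)+\frac{i\pi}{\beta}\,\operatorname{p.v.}\frac{1}{\sinh(\pi k/\beta)}.$$ 2. For every $\beta>0$ the distributions $F_{\mathrm{BE},\beta}=\operatorname{p.v.}\frac{1}{e^{\beta x}-1}$ (the Bose–Einstein function) and $\operatorname{p.v.}\coth(\pi k/\beta)$ exist, and $$\hat F_{\mathrm{BE},\beta}=\frac{\pi}{i\beta}\,\operatorname{p.v.}\coth\frac{\pi k}{\beta}-\pi\,\delta(k).$$ 3. As $\beta\to\infty$, $\hat F_{\mathrm{FD},\beta}\to\hat\Theta(-\,\cdot)$ in $\mathcal S'$. -/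

import Mathlib

open MeasureTheory Filter Topology FourierTransform
open scoped SchwartzMap ENNReal

noncomputable section

namespace QuantumStatistics

/-- The Fourier transform `φ ↦ (k ↦ ∫ φ(x) e^{-ikx} dx)` on Schwartz functions; it is Mathlib's
transform (with kernel `e^{-2πixξ}`) evaluated at `ξ = k / (2π)`, see `schwartzFourier_apply`. -/
def schwartzFourier : 𝓢(ℝ, ℂ) →L[ℂ] 𝓢(ℝ, ℂ) :=
  (SchwartzMap.compCLMOfContinuousLinearEquiv ℂ
    (ContinuousLinearEquiv.unitsEquivAut ℝ
      (Units.mk0 ((2 * Real.pi)⁻¹ : ℝ) (inv_ne_zero Real.two_pi_pos.ne')))).comp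
    (fourierCLM ℂ 𝓢(ℝ, ℂ))

theorem schwartzFourier_apply (φ : 𝓢(ℝ, ℂ)) (k : ℝ) :
    schwartzFourier φ k = ∫ x : ℝ, φ x * Complex.exp (-Complex.I * k * x) := by
  have h : schwartzFourier φ k = 𝓕 (φ : ℝ → ℂ) (k * (2 * Real.pi)⁻¹) := by
    simp [schwartzFourier, SchwartzMap.fourier_coe]
  rw [h, Real.fourier_real_eq_integral_exp_smul]
  refine integral_congr_ae (Eventually.of_forall fun x => ?_)
  have hpi : (Real.pi : ℂ) ≠ 0 := by exact_mod_cast Real.pi_ne_zero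
  simp only [smul_eq_mul]
  rw [mul_comm]
  congr 2
  push_cast
  field_simp

/-- Reflection `φ ↦ (x ↦ φ(-x))` on Schwartz functions. -/
def schwartzReflect : 𝓢(ℝ, ℂ) →L[ℂ] 𝓢(ℝ, ℂ) :=
  SchwartzMap.compCLMOfContinuousLinearEquiv ℂ (ContinuousLinearEquiv.neg ℝ)

theorem schwartzReflect_apply (φ : 𝓢(ℝ, ℂ)) (x : ℝ) : schwartzReflect φ x = φ (-x) := by
  simp [schwartzReflect]

/-- The Fourier transform of a tempered distribution, `⟨û, φ⟩ = ⟨u, φ̂⟩`, with kernel `e^{-ikx}`. -/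
def fourierDist (u : 𝓢'(ℝ, ℂ)) : 𝓢'(ℝ, ℂ) :=
  PointwiseConvergenceCLM.precomp ℂ schwartzFourier u

theorem fourierDist_apply (u : 𝓢'(ℝ, ℂ)) (φ : 𝓢(ℝ, ℂ)) :
    fourierDist u φ = u (schwartzFourier φ) := rfl

/-- The distribution `u(-k)`, that is, `⟨u(-·), φ⟩ = ⟨u, φ(-·)⟩`. -/
def reflectDist (u : 𝓢'(ℝ, ℂ)) : 𝓢'(ℝ, ℂ) :=
  PointwiseConvergenceCLM.precomp ℂ schwartzReflect u

theorem reflectDist_apply (u : 𝓢'(ℝ, ℂ)) (φ : 𝓢(ℝ, ℂ)) :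
    reflectDist u φ = u (schwartzReflect φ) := rfl

/-- The tempered distribution `φ ↦ ∫ f φ` of an essentially bounded function `f`. -/
def regularDist (f : ℝ → ℂ) (hf : MemLp f ∞ volume) : 𝓢'(ℝ, ℂ) :=
  Lp.toTemperedDistribution (hf.toLp f)

theorem regularDist_apply (f : ℝ → ℂ) (hf : MemLp f ∞ volume) (φ : 𝓢(ℝ, ℂ)) :
    regularDist f hf φ = ∫ x : ℝ, f x * φ x := by
  rw [regularDist, Lp.toTemperedDistribution_apply]
  refine integral_congr_ae ?_
  filter_upwards [hf.coeFn_toLp] with x hx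
  rw [hx, smul_eq_mul, mul_comm]

/-- `u` is the principal value distribution (at the origin) of the function `f`:
`⟨u, φ⟩ = lim_{ε → 0+} ∫_{|x| > ε} f φ` for every Schwartz function `φ`, where the truncated
integrals converge absolutely. -/
def IsPrincipalValue (f : ℝ → ℂ) (u : 𝓢'(ℝ, ℂ)) : Prop :=
  ∀ φ : 𝓢(ℝ, ℂ),
    (∀ ε : ℝ, 0 < ε → IntegrableOn (fun x : ℝ => f x * φ x) {x : ℝ | ε < |x|}) ∧
    Tendsto (fun ε : ℝ => ∫ x in {x : ℝ | ε < |x|}, f x * φ x) (𝓝[>] 0) (𝓝 (u φ))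

/-- A function has at most one principal value distribution. -/
theorem IsPrincipalValue.unique {f : ℝ → ℂ} {u v : 𝓢'(ℝ, ℂ)}
    (hu : IsPrincipalValue f u) (hv : IsPrincipalValue f v) : u = v := by
  ext φ
  exact tendsto_nhds_unique (hu φ).2 (hv φ).2

/-- The Fermi-Dirac function `1 / (e^{βx} + 1)`. -/
def fermiDirac (β x : ℝ) : ℂ := ((1 / (Real.exp (β * x) + 1) : ℝ) : ℂ)

/-- The Bose-Einstein function `1 / (e^{βx} - 1)`. -/
def boseEinstein (β x : ℝ) : ℂ := ((1 / (Real.exp (β * x) - 1) : ℝ) : ℂ)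

/-- Heaviside's unit step function. -/
def heaviside (x : ℝ) : ℂ := if 0 < x then 1 else 0

theorem memLp_fermiDirac (β : ℝ) : MemLp (fermiDirac β) ∞ volume := by
  refine memLp_top_of_bound (C := 1) ?_ (Eventually.of_forall fun x => ?_)
  · refine Measurable.aestronglyMeasurable ?_
    unfold fermiDirac
    fun_prop
  · have h := Real.exp_pos (β * x)
    rw [fermiDirac, Complex.norm_real, Real.norm_of_nonneg (by positivity),
      div_le_one (by positivity)]
    linarith

theorem memLp_heaviside : MemLp heaviside ∞ volume := by
  refine memLp_top_of_bound (C := 1) ?_ (Eventually.of_forall fun x => ?_)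
  · exact (Measurable.ite measurableSet_Ioi measurable_const
      measurable_const).aestronglyMeasurable
  · unfold heaviside
    split_ifs <;> simp

/-- The Fermi-Dirac function as a tempered distribution. -/
def fermiDiracDist (β : ℝ) : 𝓢'(ℝ, ℂ) := regularDist (fermiDirac β) (memLp_fermiDirac β)

/-- Heaviside's unit step function as a tempered distribution. -/
def heavisideDist : 𝓢'(ℝ, ℂ) := regularDist heaviside memLp_heaviside

end QuantumStatistics

end

namespace QuantumStatistics

open Set

/-! Everything reduces to one identity: the Fourier transform of p.v. coth(βx/2) is 2π/(iβ) p.v.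
coth(πk/β) (`integral_coth_mul_schwartzFourier`). For an odd kernel f of size O(1 + 1/x), p.v. f
pairs with φ as the absolutely convergent integral of f(x)(φ(x) - φ(-x)) over x > 0, so only
half-line integrals occur.

For x, k > 0, coth(βx/2) = 1 + 2 ∑ e^{-jβx} and (π/β) coth(πk/β) = 1/k + 2 ∑ k/(j²β² + k²), with j ≥
1. The odd extension of e^{-ax} transforms to -2ik/(a² + k²), so the series match term by term. The
leading 1 is the limit a → 0; taking a = 1/(N+1) in the N-th partial sum keeps all terms integrable
and both sequences increasing, so each limit dominates its own sequence.

The Bose–Einstein function is (coth(βx/2) - 1)/2, and 1 transforms to 2πδ. The Fermi–Dirac case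
follows from F_FD,β = F_BE,β - 2 F_BE,2β and 1/sinh y = coth(y/2) - coth y. The limit β → ∞ is
dominated convergence on the x side. -/

theorem norm_sub_neg_le (φ : 𝓢(ℝ, ℂ)) {x : ℝ} (hx : 0 < x) :
    (1 + 1 / x) * ‖φ x - φ (-x)‖ ≤
      8 * (SchwartzMap.seminorm ℂ 0 1 φ + SchwartzMap.seminorm ℂ 0 0 φ +
        SchwartzMap.seminorm ℂ 2 0 φ) * (1 + x ^ 2)⁻¹ := by
  set p := SchwartzMap.seminorm ℂ 0 1 φ with hp
  set q := SchwartzMap.seminorm ℂ 0 0 φ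
  set r := SchwartzMap.seminorm ℂ 2 0 φ
  have hp0 : 0 ≤ p := apply_nonneg _ _
  have hq0 : 0 ≤ q := apply_nonneg _ _
  have hr0 : 0 ≤ r := apply_nonneg _ _
  have h1 : ‖φ x - φ (-x)‖ ≤ p * (2 * x) := by
    have h := Convex.norm_image_sub_le_of_norm_deriv_le (𝕜 := ℝ) (f := φ) (C := p) (s := univ)
      (x := -x) (y := x) (fun y _ => φ.differentiableAt)
      (fun y _ => by simpa using φ.le_seminorm' ℂ 0 1 y) convex_univ trivial trivial
    rwa [show x - -x = 2 * x by ring, Real.norm_of_nonneg (by positivity)] at h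
  have h2 (y : ℝ) : (1 + y ^ 2) * ‖φ y‖ ≤ q + r := by
    have ha := φ.norm_le_seminorm ℂ y
    have hb := φ.norm_pow_mul_le_seminorm ℂ 2 y
    rw [Real.norm_eq_abs, sq_abs] at hb
    linarith
  have h3 : (1 + x ^ 2) * ‖φ x - φ (-x)‖ ≤ 2 * (q + r) := by
    have ha := h2 x
    have hb := h2 (-x)
    rw [neg_sq] at hb
    have hc := mul_le_mul_of_nonneg_left (norm_sub_le (φ x) (φ (-x)))
      (show 0 ≤ 1 + x ^ 2 by positivity)
    linarith
  rw [← div_eq_mul_inv, le_div_iff₀ (by positivity)]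
  -- For x ≤ 1 the mean value bound absorbs 1/x and yields 8p; for x ≥ 1 Schwartz decay yields 4(q +
  -- r).
  rcases le_total x 1 with hx1 | hx1
  · have h4 : (1 + 1 / x) * (p * (2 * x)) = 2 * p * (x + 1) := by field_simp
    calc (1 + 1 / x) * ‖φ x - φ (-x)‖ * (1 + x ^ 2)
        ≤ (1 + 1 / x) * (p * (2 * x)) * (1 + x ^ 2) := by gcongr
      _ = 2 * p * (x + 1) * (1 + x ^ 2) := by rw [h4]
      _ ≤ 2 * p * (1 + 1) * (1 + 1 ^ 2) := by gcongr
      _ ≤ _ := by linarith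
  · have h4 : 1 / x ≤ 1 := by rwa [div_le_one hx]
    calc (1 + 1 / x) * ‖φ x - φ (-x)‖ * (1 + x ^ 2)
        = (1 + 1 / x) * ((1 + x ^ 2) * ‖φ x - φ (-x)‖) := by ring
      _ ≤ (1 + 1) * (2 * (q + r)) := by gcongr
      _ ≤ _ := by linarith

/-! ### Principal values of odd kernels -/

section OddKernel

variable {f : ℝ → ℂ} {C : ℝ}

theorem norm_mul_sub_neg_le (hb : ∀ x : ℝ, 0 < x → ‖f x‖ ≤ C * (1 + 1 / x)) (φ : 𝓢(ℝ, ℂ))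
    {x : ℝ} (hx : 0 < x) :
    ‖f x * (φ x - φ (-x))‖ ≤ C * (8 * (SchwartzMap.seminorm ℂ 0 1 φ +
      SchwartzMap.seminorm ℂ 0 0 φ + SchwartzMap.seminorm ℂ 2 0 φ)) * (1 + x ^ 2)⁻¹ := by
  have hC : 0 ≤ C := by
    have h := (norm_nonneg _).trans (hb 1 one_pos)
    linarith
  rw [norm_mul, mul_assoc C]
  calc ‖f x‖ * ‖φ x - φ (-x)‖ ≤ C * (1 + 1 / x) * ‖φ x - φ (-x)‖ := by
        gcongr
        exact hb x hx
    _ = C * ((1 + 1 / x) * ‖φ x - φ (-x)‖) := by ring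
    _ ≤ _ := by
        exact mul_le_mul_of_nonneg_left (norm_sub_neg_le φ hx) hC

theorem integrableOn_mul_sub_neg (hm : Measurable f)
    (hb : ∀ x : ℝ, 0 < x → ‖f x‖ ≤ C * (1 + 1 / x)) (φ : 𝓢(ℝ, ℂ)) :
    IntegrableOn (fun x => f x * (φ x - φ (-x))) (Ioi 0) := by
  refine Integrable.mono' ((integrable_inv_one_add_sq.const_mul _).integrableOn)
    (hm.aestronglyMeasurable.mul ?_)
    ((ae_restrict_iff' measurableSet_Ioi).2 (Eventually.of_forall fun x hx =>
      norm_mul_sub_neg_le hb φ hx))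
  have := φ.continuous
  exact (by fun_prop : Continuous fun x => φ x - φ (-x)).aestronglyMeasurable

theorem integrableOn_mul_schwartz {s : Set ℝ} (hs : MeasurableSet s) {K : ℝ} (hm : Measurable f)
    (hb : ∀ x ∈ s, ‖f x‖ ≤ K) (φ : 𝓢(ℝ, ℂ)) :
    IntegrableOn (fun x => f x * φ x) s :=
  Integrable.bdd_mul φ.integrable.integrableOn hm.aestronglyMeasurable
    ((ae_restrict_iff' hs).2 (Eventually.of_forall hb))

theorem setOf_lt_abs (ε : ℝ) : {x : ℝ | ε < |x|} = Ioi ε ∪ Iio (-ε) := by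
  ext x
  simp only [mem_ofPred_eq, lt_abs, mem_union, mem_Ioi, mem_Iio]
  constructor <;> rintro (h | h)
  · exact Or.inl h
  · exact Or.inr (by linarith)
  · exact Or.inl h
  · exact Or.inr (by linarith)

theorem measurableSet_lt_abs (ε : ℝ) : MeasurableSet {x : ℝ | ε < |x|} := by
  rw [setOf_lt_abs]
  exact measurableSet_Ioi.union measurableSet_Iio

theorem norm_le_of_lt_abs (ho : ∀ x, f (-x) = -f x)
    (hb : ∀ x : ℝ, 0 < x → ‖f x‖ ≤ C * (1 + 1 / x)) {ε : ℝ} (hε : 0 < ε) {x : ℝ}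
    (hx : ε < |x|) : ‖f x‖ ≤ C * (1 + 1 / ε) := by
  have hC : 0 ≤ C := by
    have h := (norm_nonneg _).trans (hb 1 one_pos)
    linarith
  have h1 : ‖f x‖ = ‖f |x|‖ := by
    rcases abs_choice x with h | h <;> rw [h]
    rw [ho, norm_neg]
  rw [h1]
  refine (hb _ (hε.trans hx)).trans ?_
  gcongr

/-- Oddness folds the negative half of the truncated domain onto the positive half. -/
theorem setIntegral_lt_abs_mul (hm : Measurable f) (ho : ∀ x, f (-x) = -f x)
    (hb : ∀ x : ℝ, 0 < x → ‖f x‖ ≤ C * (1 + 1 / x)) (φ : 𝓢(ℝ, ℂ)) {ε : ℝ} (hε : 0 < ε) :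
    ∫ x in {x : ℝ | ε < |x|}, f x * φ x = ∫ x in Ioi ε, f x * (φ x - φ (-x)) := by
  have hint := integrableOn_mul_schwartz (measurableSet_lt_abs ε) hm
    (fun x hx => norm_le_of_lt_abs ho hb hε hx) φ
  rw [setOf_lt_abs] at hint ⊢
  have hd : Disjoint (Ioi ε) (Iio (-ε)) := by
    rw [Set.disjoint_left]
    intro x (h1 : ε < x) (h2 : x < -ε)
    linarith
  have h1 := hint.mono_set subset_union_left
  have h2 : IntegrableOn (fun x => f (-x) * φ (-x)) (Ioi ε) := by
    have h := (hint.mono_set subset_union_right).comp_neg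
    simpa using h
  rw [setIntegral_union hd measurableSet_Iio h1 (hint.mono_set subset_union_right),
    ← integral_Iic_eq_integral_Iio, ← integral_comp_neg_Ioi ε (fun x => f x * φ x),
    ← integral_add h1 h2]
  refine integral_congr_ae (Eventually.of_forall fun x => ?_)
  simp only [ho]
  ring

theorem exists_isPrincipalValue_of_odd (hm : Measurable f) (ho : ∀ x, f (-x) = -f x)
    (hb : ∀ x : ℝ, 0 < x → ‖f x‖ ≤ C * (1 + 1 / x)) :
    ∃ u : 𝓢'(ℝ, ℂ), IsPrincipalValue f u ∧
      ∀ φ : 𝓢(ℝ, ℂ), u φ = ∫ x in Ioi (0 : ℝ), f x * (φ x - φ (-x)) := by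
  have hC : 0 ≤ C := by
    have h := (norm_nonneg _).trans (hb 1 one_pos)
    linarith
  have hI := fun φ : 𝓢(ℝ, ℂ) => integrableOn_mul_sub_neg hm hb φ
  let u : 𝓢(ℝ, ℂ) →L[ℂ] ℂ := SchwartzMap.mkCLMtoNormedSpace
    (fun φ : 𝓢(ℝ, ℂ) => ∫ x in Ioi (0 : ℝ), f x * (φ x - φ (-x)))
    (fun φ ψ => by
      rw [← integral_add (hI φ) (hI ψ)]
      refine integral_congr_ae (Eventually.of_forall fun x => ?_)
      simp only [add_apply]
      ring)
    (fun a φ => by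
      rw [RingHom.id_apply, smul_eq_mul, ← integral_const_mul]
      refine integral_congr_ae (Eventually.of_forall fun x => ?_)
      simp only [smul_apply, smul_eq_mul]
      ring)
    -- 24 = 8 · 3: each of the three seminorms in the pointwise bound is at most their supremum.
    ⟨{(0, 1), (0, 0), (2, 0)}, C * 24 * ∫ x in Ioi (0 : ℝ), (1 + x ^ 2)⁻¹,
      mul_nonneg (by positivity) (integral_nonneg fun x => by positivity), fun φ => by
      set S := (({(0, 1), (0, 0), (2, 0)} : Finset (ℕ × ℕ)).sup
        (schwartzSeminormFamily ℂ ℝ ℂ)) φ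
      have hs (m : ℕ × ℕ) (hm : m ∈ ({(0, 1), (0, 0), (2, 0)} : Finset (ℕ × ℕ))) :
          schwartzSeminormFamily ℂ ℝ ℂ m φ ≤ S :=
        (Finset.le_sup (f := schwartzSeminormFamily ℂ ℝ ℂ) hm : _) φ
      have h1 : SchwartzMap.seminorm ℂ 0 1 φ ≤ S := hs (0, 1) (by simp)
      have h2 : SchwartzMap.seminorm ℂ 0 0 φ ≤ S := hs (0, 0) (by simp)
      have h3 : SchwartzMap.seminorm ℂ 2 0 φ ≤ S := hs (2, 0) (by simp)
      refine (norm_integral_le_of_norm_le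
        ((integrable_inv_one_add_sq.const_mul (C * 24 * S)).integrableOn)
        ((ae_restrict_iff' measurableSet_Ioi).2 (Eventually.of_forall fun x hx => ?_))).trans_eq ?_
      · refine (norm_mul_sub_neg_le hb φ hx).trans ?_
        have h4 : 0 ≤ C * (1 + x ^ 2)⁻¹ := by positivity
        nlinarith [mul_le_mul_of_nonneg_left h1 h4, mul_le_mul_of_nonneg_left h2 h4,
          mul_le_mul_of_nonneg_left h3 h4]
      · rw [integral_const_mul]
        ring⟩
  refine ⟨ContinuousLinearMap.toPointwiseConvergenceCLM ℂ _ _ _ u, fun φ => ⟨fun ε hε =>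
    integrableOn_mul_schwartz (measurableSet_lt_abs ε) hm
      (fun x hx => norm_le_of_lt_abs ho hb hε hx) φ, ?_⟩, fun φ => rfl⟩
  have hcov : AECover (volume.restrict (Ioi (0 : ℝ))) (𝓝[>] 0) fun ε : ℝ => Ioi ε :=
    aecover_Ioi_of_Ioi (tendsto_id.mono_left nhdsWithin_le_nhds)
  have h := hcov.integral_tendsto_of_countably_generated (hI φ)
  refine Tendsto.congr' ?_ h
  filter_upwards [self_mem_nhdsWithin] with ε (hε : 0 < ε)
  rw [setIntegral_lt_abs_mul hm ho hb φ hε, Measure.restrict_restrict measurableSet_Ioi,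
    inter_eq_left.2 (Ioi_subset_Ioi hε.le)]

end OddKernel

/-- The truncations never see the origin, so default values of division by zero there are harmless.
-/
theorem IsPrincipalValue.congr {f g : ℝ → ℂ} {u : 𝓢'(ℝ, ℂ)} (hu : IsPrincipalValue f u)
    (h : ∀ x, x ≠ 0 → f x = g x) : IsPrincipalValue g u := by
  intro φ
  have he (ε : ℝ) (hε : 0 < ε) : EqOn (fun x => f x * φ x) (fun x => g x * φ x)
      {x : ℝ | ε < |x|} := fun x (hx : ε < |x|) => by
    simp only [h x (abs_pos.1 (hε.trans hx))]
  refine ⟨fun ε hε => ((hu φ).1 ε hε).congr_fun (he ε hε) (measurableSet_lt_abs ε),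
    (hu φ).2.congr' ?_⟩
  filter_upwards [self_mem_nhdsWithin] with ε (hε : 0 < ε)
  exact setIntegral_congr_fun (measurableSet_lt_abs ε) (he ε hε)

theorem IsPrincipalValue.sub {f g : ℝ → ℂ} {u v : 𝓢'(ℝ, ℂ)} (hu : IsPrincipalValue f u)
    (hv : IsPrincipalValue g v) : IsPrincipalValue (fun x => f x - g x) (u - v) := by
  intro φ
  have hs (x : ℝ) : (f x - g x) * φ x = f x * φ x - g x * φ x := sub_mul _ _ _
  simp only [hs]
  refine ⟨fun ε hε => ((hu φ).1 ε hε).sub ((hv φ).1 ε hε),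
    ((hu φ).2.sub (hv φ).2).congr' ?_⟩
  filter_upwards [self_mem_nhdsWithin] with ε (hε : 0 < ε)
  exact (integral_sub ((hu φ).1 ε hε) ((hv φ).1 ε hε)).symm

theorem IsPrincipalValue.const_smul {f : ℝ → ℂ} {u : 𝓢'(ℝ, ℂ)} (hu : IsPrincipalValue f u)
    (c : ℂ) : IsPrincipalValue (fun x => c * f x) (c • u) := by
  intro φ
  simp only [mul_assoc, integral_const_mul]
  exact ⟨fun ε hε => ((hu φ).1 ε hε).const_mul c, (hu φ).2.const_mul c⟩

theorem isPrincipalValue_regularDist (f : ℝ → ℂ) (hf : MemLp f ∞ volume) :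
    IsPrincipalValue f (regularDist f hf) := by
  intro φ
  have hi : Integrable (fun x => f x * φ x) := by
    simpa [Pi.mul_def] using φ.integrable (μ := volume).mul_of_top_right hf
  refine ⟨fun ε _ => hi.integrableOn, ?_⟩
  rw [regularDist_apply]
  have hcov : AECover (volume : Measure ℝ) (𝓝[>] 0) fun ε : ℝ => {x : ℝ | ε < |x|} := by
    refine ⟨?_, measurableSet_lt_abs⟩
    filter_upwards [Measure.ae_ne volume (0 : ℝ)] with x hx
    exact (tendsto_id.mono_left nhdsWithin_le_nhds).eventually_lt_const (abs_pos.2 hx)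
  exact hcov.integral_tendsto_of_countably_generated hi

/-! ### Hyperbolic identities and series -/

/-- The hyperbolic cotangent. -/
noncomputable def coth (y : ℝ) : ℝ := Real.cosh y / Real.sinh y

theorem coth_neg (y : ℝ) : coth (-y) = -coth y := by
  simp [coth, div_neg]

theorem measurable_coth : Measurable coth := by
  unfold coth
  fun_prop

theorem coth_pos {y : ℝ} (hy : 0 < y) : 0 < coth y :=
  div_pos (Real.cosh_pos y) (Real.sinh_pos_iff.2 hy)

theorem coth_le {y : ℝ} (hy : 0 < y) : coth y ≤ 1 + 1 / y := by
  have hs : y ≤ Real.sinh y := Real.self_le_sinh_iff.2 hy.le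
  have hc : Real.cosh y = Real.sinh y + Real.exp (-y) := by
    rw [← Real.cosh_sub_sinh]
    ring
  have he : Real.exp (-y) ≤ 1 := Real.exp_le_one_iff.2 (by linarith)
  rw [coth, hc, add_div, div_self (by linarith)]
  gcongr

theorem coth_half (y : ℝ) (hy : y ≠ 0) : coth (y / 2) = 1 + 2 / (Real.exp y - 1) := by
  have h1 : Real.exp y - 1 ≠ 0 := by simpa [sub_eq_zero] using hy
  have h2 : Real.exp y = Real.exp (y / 2) * Real.exp (y / 2) := by
    rw [← Real.exp_add]
    ring_nf
  have h3 := Real.exp_pos (y / 2)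
  rw [coth, Real.cosh_eq, Real.sinh_eq, Real.exp_neg]
  rw [h2] at h1 ⊢
  have h4 : Real.exp (y / 2) - (Real.exp (y / 2))⁻¹ ≠ 0 := by
    intro h
    apply h1
    field_simp at h
    linarith
  generalize Real.exp (y / 2) = e at *
  have h5 : e ^ 2 - 1 ≠ 0 := by rwa [sq]
  field_simp
  ring

theorem one_div_sinh (y : ℝ) : 1 / Real.sinh y = coth (y / 2) - coth y := by
  rcases eq_or_ne y 0 with rfl | hy
  -- At 0 both sides vanish by the convention for division by zero.
  · simp [coth]
  have h : Real.sinh (y / 2) ≠ 0 := by simpa using hy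
  have hc := Real.cosh_pos (y / 2)
  have hd : y = 2 * (y / 2) := by ring
  generalize y / 2 = z at *
  subst hd
  have := Real.cosh_sq z
  rw [coth, coth, Real.sinh_two_mul, Real.cosh_two_mul]
  field_simp
  linarith

/-- This is the Mittag-Leffler expansion of π cot(πz) - 1/z at z = it, multiplied by i. -/
theorem tendsto_sum_coth {t : ℝ} (ht : 0 < t) :
    Tendsto (fun N : ℕ => ∑ j ∈ Finset.range N, 2 * t / (t ^ 2 + (j + 1) ^ 2)) atTop
      (𝓝 (Real.pi * coth (Real.pi * t) - 1 / t)) := by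
  have hz : (t : ℂ) * Complex.I ∈ Complex.integerComplement := by
    rintro ⟨n, hn⟩
    have := congrArg Complex.im hn
    simp at this
    linarith
  have h := (tendsto_logDeriv_euler_cot_sub hz).const_mul Complex.I
  have h' := (Complex.continuous_re.tendsto _).comp h
  have htc : (t : ℂ) ≠ 0 := by exact_mod_cast ht.ne'
  convert h' using 1
  · ext N
    simp only [Function.comp, Finset.mul_sum, Complex.re_sum]
    refine Finset.sum_congr rfl fun j _ => ?_
    have hj : Complex.I * cotTerm ((t : ℂ) * Complex.I) j =
        ((2 * t / (t ^ 2 + (j + 1) ^ 2) : ℝ) : ℂ) := by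
      have h0 : (t : ℂ) ^ 2 + (j + 1) ^ 2 ≠ 0 := by
        have : t ^ 2 + ((j : ℝ) + 1) ^ 2 ≠ 0 := by positivity
        exact_mod_cast this
      have h1 : ((t : ℂ) * Complex.I + (j + 1)) * ((t : ℂ) * Complex.I - (j + 1)) =
          -((t : ℂ) ^ 2 + (j + 1) ^ 2) := by
        linear_combination (t : ℂ) ^ 2 * Complex.I_sq
      rw [cotTerm_identity hz, h1]
      push_cast
      field_simp
      rw [Complex.I_sq]
      ring
    rw [hj, Complex.ofReal_re]
  · congr 1
    have hs : (Complex.sinh (Real.pi * t)) ≠ 0 := by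
      have : Real.sinh (Real.pi * t) ≠ 0 := by
        simpa using ht.ne'
      exact_mod_cast this
    have he : Complex.I * (Real.pi * Complex.cot (Real.pi * ((t : ℂ) * Complex.I)) -
        1 / ((t : ℂ) * Complex.I)) = ((Real.pi * coth (Real.pi * t) - 1 / t : ℝ) : ℂ) := by
      rw [← mul_assoc (Real.pi : ℂ), Complex.cot, Complex.cos_mul_I, Complex.sin_mul_I, coth]
      push_cast
      field_simp
    rw [he, Complex.ofReal_re]

theorem tendsto_sum_exp {y : ℝ} (hy : 0 < y) :
    Tendsto (fun N : ℕ => ∑ j ∈ Finset.range N, Real.exp (-((j + 1) * y))) atTop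
      (𝓝 (1 / (Real.exp y - 1))) := by
  have h1 : Real.exp (-y) < 1 := Real.exp_lt_one_iff.2 (by linarith)
  have h := ((hasSum_geometric_of_lt_one (Real.exp_pos _).le h1).mul_left
    (Real.exp (-y))).tendsto_sum_nat
  convert h using 1
  · ext N
    refine Finset.sum_congr rfl fun j _ => ?_
    rw [← Real.exp_nat_mul, ← Real.exp_add]
    ring_nf
  · congr 1
    have h2 : 1 < Real.exp y := Real.one_lt_exp_iff.2 hy
    have h3 : 1 - Real.exp (-y) ≠ 0 := by linarith
    have h4 : Real.exp y - 1 ≠ 0 := by linarith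
    rw [Real.exp_neg] at h3 ⊢
    field_simp

/-! ### Fourier transforms of constants and exponentials -/

theorem schwartzFourier_schwartzReflect (φ : 𝓢(ℝ, ℂ)) (x : ℝ) :
    schwartzFourier (schwartzReflect φ) x = schwartzFourier φ (-x) := by
  rw [schwartzFourier_apply, schwartzFourier_apply, ← integral_neg_eq_self]
  refine integral_congr_ae (Eventually.of_forall fun k => ?_)
  simp [schwartzReflect_apply]

/-- Fourier inversion at 0, with 2π from rescaling the frequency; it says that 1 transforms to 2πδ.
-/
theorem integral_schwartzFourier (φ : 𝓢(ℝ, ℂ)) :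
    ∫ x, schwartzFourier φ x = 2 * Real.pi * φ 0 := by
  have h (k : ℝ) : schwartzFourier φ k = 𝓕 φ (k * (2 * Real.pi)⁻¹) := by
    simp [schwartzFourier]
  simp only [h]
  rw [Measure.integral_comp_mul_right (fun x => 𝓕 φ x), inv_inv,
    abs_of_pos Real.two_pi_pos, Complex.real_smul]
  have h2 : ∫ x, 𝓕 φ x = φ 0 := by
    have h3 : 𝓕⁻ (𝓕 φ) 0 = φ 0 := by rw [FourierTransform.fourierInv_fourier_eq]
    rw [← h3, SchwartzMap.fourierInv_coe, Real.fourierInv_eq']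
    simp
  rw [h2]
  push_cast
  ring

/-- The damping a > 0 justifies Fubini; the inner integral of e^{-(a+ik)x} is then elementary. -/
theorem integral_exp_mul_schwartzFourier (g : 𝓢(ℝ, ℂ)) {a : ℝ} (ha : 0 < a) :
    ∫ x in Ioi (0 : ℝ), (Real.exp (-(a * x)) : ℂ) * schwartzFourier g x =
      ∫ k, g k * (1 / (a + Complex.I * k)) := by
  have hexp : Integrable (fun x : ℝ => (Real.exp (-(a * x)) : ℂ)) (volume.restrict (Ioi 0)) := by
    have h := exp_neg_integrableOn_Ioi 0 ha
    simp only [neg_mul] at h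
    exact h.ofReal
  have hint : Integrable (Function.uncurry fun x k : ℝ =>
      (Real.exp (-(a * x)) : ℂ) * (g k * Complex.exp (-Complex.I * x * k)))
      ((volume.restrict (Ioi 0)).prod volume) := by
    have h := (hexp.mul_prod (g.integrable (μ := volume)))
    have h2 := Integrable.bdd_mul (c := 1) (f := fun z : ℝ × ℝ =>
      Complex.exp (-Complex.I * z.1 * z.2)) h
      (by fun_prop : Continuous _).aestronglyMeasurable
      (Eventually.of_forall fun z => by
        rw [show -Complex.I * z.1 * z.2 = ((-(z.1 * z.2) : ℝ) : ℂ) * Complex.I by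
          push_cast; ring, Complex.norm_exp_ofReal_mul_I])
    refine h2.congr (Eventually.of_forall fun z => ?_)
    simp only [Function.uncurry]
    ring
  simp only [schwartzFourier_apply, ← integral_const_mul]
  rw [integral_integral_swap hint]
  refine integral_congr_ae (Eventually.of_forall fun k => ?_)
  have hre : (-(a + Complex.I * k) : ℂ).re < 0 := by simpa using ha
  have h := integral_exp_mul_complex_Ioi hre 0
  simp only [Complex.ofReal_zero, mul_zero, Complex.exp_zero] at h
  rw [neg_div_neg_eq] at h
  simp only
  rw [← h, ← integral_const_mul]
  refine integral_congr_ae (Eventually.of_forall fun x => ?_)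
  simp only [Complex.ofReal_exp]
  rw [mul_left_comm, ← Complex.exp_add]
  congr 2
  push_cast
  ring

theorem integral_eq_integral_Ioi_add_neg {h : ℝ → ℂ} (hh : Integrable h) :
    ∫ x, h x = ∫ x in Ioi (0 : ℝ), (h x + h (-x)) := by
  have h2 : IntegrableOn (fun x => h (-x)) (Ioi 0) := hh.comp_neg.integrableOn
  rw [integral_add hh.integrableOn h2, integral_comp_neg_Ioi, neg_zero, add_comm,
    intervalIntegral.integral_Iic_add_Ioi hh.integrableOn hh.integrableOn]

theorem integral_exp_mul_schwartzFourier_sub_neg (φ : 𝓢(ℝ, ℂ)) {a : ℝ} (ha : 0 < a) :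
    ∫ x in Ioi (0 : ℝ), (Real.exp (-(a * x)) : ℂ) *
        (schwartzFourier φ x - schwartzFourier φ (-x)) =
      -2 * Complex.I * ∫ k in Ioi (0 : ℝ), ((k / (a ^ 2 + k ^ 2) : ℝ) : ℂ) * (φ k - φ (-k)) := by
  -- Folding the k-integral for this odd test function gives 1/(a+ik) - 1/(a-ik) = -2ik/(a² + k²).
  have h := integral_exp_mul_schwartzFourier (φ - schwartzReflect φ) ha
  simp only [map_sub, sub_apply, schwartzFourier_schwartzReflect, schwartzReflect_apply] at h
  have hne (k : ℝ) : (a + Complex.I * k : ℂ) ≠ 0 := fun h0 => ha.ne' (by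
    simpa using congrArg Complex.re h0)
  have hne' (k : ℝ) : (a - Complex.I * k : ℂ) ≠ 0 := fun h0 => ha.ne' (by
    simpa using congrArg Complex.re h0)
  have hint : Integrable fun k : ℝ => (φ k - φ (-k)) * (1 / (a + Complex.I * k)) := by
    have hg := (φ - schwartzReflect φ).integrable (μ := volume)
    have h2 := Integrable.mul_bdd (c := 1 / a) hg (g := fun k : ℝ => 1 / (a + Complex.I * k))
      (Continuous.aestronglyMeasurable (by
        refine Continuous.div (by fun_prop) (by fun_prop) hne))
      (Eventually.of_forall fun k => by
        rw [norm_div, norm_one]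
        gcongr
        simpa [abs_of_pos ha] using Complex.abs_re_le_norm (a + Complex.I * k))
    simpa [schwartzReflect_apply] using h2
  rw [h, integral_eq_integral_Ioi_add_neg hint, ← integral_const_mul]
  refine integral_congr_ae (Eventually.of_forall fun k => ?_)
  have hk : ((a : ℂ) ^ 2 + k ^ 2) = (a + Complex.I * k) * (a - Complex.I * k) := by
    linear_combination (k : ℂ) ^ 2 * Complex.I_sq
  simp only [neg_neg]
  push_cast
  rw [hk, mul_neg, ← sub_eq_add_neg]
  have h1 := hne k
  have h2 := hne' k
  field_simp
  ring

/-! ### The Fourier transform of p.v. coth -/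

theorem norm_coth_mul_le {a x : ℝ} (ha : 0 < a) (hx : 0 < x) :
    ‖((coth (a * x) : ℝ) : ℂ)‖ ≤ (1 + 1 / a) * (1 + 1 / x) := by
  rw [Complex.norm_real, Real.norm_of_nonneg (coth_pos (by positivity)).le]
  refine (coth_le (by positivity)).trans ?_
  have h : (1 + 1 / a) * (1 + 1 / x) = 1 + 1 / (a * x) + (1 / a + 1 / x) := by
    field_simp
    ring
  rw [h]
  have : 0 ≤ 1 / a + 1 / x := by positivity
  linarith

theorem measurable_coth_mul (a : ℝ) : Measurable fun x : ℝ => ((coth (a * x) : ℝ) : ℂ) :=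
  Complex.measurable_ofReal.comp (measurable_coth.comp (measurable_const_mul a))

theorem integrableOn_coth_mul {a : ℝ} (ha : 0 < a) (φ : 𝓢(ℝ, ℂ)) :
    IntegrableOn (fun x => ((coth (a * x) : ℝ) : ℂ) * (φ x - φ (-x))) (Ioi 0) :=
  integrableOn_mul_sub_neg (measurable_coth_mul a) (fun _ hx => norm_coth_mul_le ha hx) φ

theorem exists_isPrincipalValue_coth {a : ℝ} (ha : 0 < a) :
    ∃ u : 𝓢'(ℝ, ℂ), IsPrincipalValue (fun x => ((coth (a * x) : ℝ) : ℂ)) u ∧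
      ∀ φ : 𝓢(ℝ, ℂ), u φ = ∫ x in Ioi (0 : ℝ), ((coth (a * x) : ℝ) : ℂ) * (φ x - φ (-x)) :=
  exists_isPrincipalValue_of_odd (measurable_coth_mul a)
    (fun x => by rw [mul_neg, coth_neg, Complex.ofReal_neg]) (fun _ hx => norm_coth_mul_le ha hx)

/-- Increasing sums of exponentials that approximate `coth (β x / 2)` for `x > 0`. -/
noncomputable def cothExpSum (β : ℝ) (N : ℕ) (x : ℝ) : ℝ :=
  Real.exp (-(1 / ((N : ℝ) + 1) * x)) +
    2 * ∑ j ∈ Finset.range N, Real.exp (-(β * (j + 1) * x))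

/-- Increasing sums of rational functions that approximate `(π / β) coth (π k / β)` for `k > 0`. -/
noncomputable def cothRatSum (β : ℝ) (N : ℕ) (k : ℝ) : ℝ :=
  k / ((1 / ((N : ℝ) + 1)) ^ 2 + k ^ 2) +
    2 * ∑ j ∈ Finset.range N, k / ((β * (j + 1)) ^ 2 + k ^ 2)

theorem tendsto_cothExpSum {β x : ℝ} (hβ : 0 < β) (hx : 0 < x) :
    Tendsto (fun N => cothExpSum β N x) atTop (𝓝 (coth (β / 2 * x))) := by
  have h1 := ((tendsto_one_div_add_atTop_nhds_zero_nat (𝕜 := ℝ)).mul_const x).neg.rexp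
  rw [zero_mul, neg_zero, Real.exp_zero] at h1
  have h2 := (tendsto_sum_exp (mul_pos hβ hx)).const_mul 2
  have h3 := coth_half (β * x) (mul_pos hβ hx).ne'
  rw [show β / 2 * x = β * x / 2 by ring, h3, show 2 / (Real.exp (β * x) - 1) =
    2 * (1 / (Real.exp (β * x) - 1)) by ring]
  refine (h1.add h2).congr fun N => ?_
  rw [cothExpSum]
  congr 2
  refine Finset.sum_congr rfl fun j _ => ?_
  ring_nf

theorem tendsto_cothRatSum {β k : ℝ} (hβ : 0 < β) (hk : 0 < k) :
    Tendsto (fun N => cothRatSum β N k) atTop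
      (𝓝 (Real.pi / β * coth (Real.pi / β * k))) := by
  have h1 := (((tendsto_one_div_add_atTop_nhds_zero_nat (𝕜 := ℝ)).pow 2).add_const (k ^ 2)).inv₀
    (by positivity)
  have h1 := h1.const_mul k
  have h2 := (tendsto_sum_coth (div_pos hk hβ)).const_mul (1 / β)
  convert (h1.add h2) using 1
  · ext N
    rw [cothRatSum, div_eq_mul_inv, Finset.mul_sum, Finset.mul_sum]
    congr 1
    refine Finset.sum_congr rfl fun j _ => ?_
    have : (β * ((j : ℝ) + 1)) ^ 2 + k ^ 2 ≠ 0 := by positivity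
    have : (k / β) ^ 2 + ((j : ℝ) + 1) ^ 2 ≠ 0 := by positivity
    field_simp
    ring
  · congr 1
    rw [show Real.pi * (k / β) = Real.pi / β * k by ring]
    field_simp
    ring

theorem cothExpSum_nonneg (β : ℝ) (N : ℕ) (x : ℝ) : 0 ≤ cothExpSum β N x := by
  unfold cothExpSum
  positivity

theorem cothRatSum_nonneg (β : ℝ) (N : ℕ) {k : ℝ} (hk : 0 < k) : 0 ≤ cothRatSum β N k := by
  unfold cothRatSum
  positivity

theorem monotone_cothExpSum (β : ℝ) {x : ℝ} (hx : 0 < x) :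
    Monotone fun N => cothExpSum β N x := by
  intro M N h
  simp only [cothExpSum]
  refine add_le_add (by gcongr) (mul_le_mul_of_nonneg_left ?_ zero_le_two)
  exact Finset.sum_le_sum_of_subset_of_nonneg (Finset.range_mono h) fun j _ _ => by positivity

theorem monotone_cothRatSum (β : ℝ) {k : ℝ} (hk : 0 < k) :
    Monotone fun N => cothRatSum β N k := by
  intro M N h
  simp only [cothRatSum]
  refine add_le_add (by gcongr) (mul_le_mul_of_nonneg_left ?_ zero_le_two)
  exact Finset.sum_le_sum_of_subset_of_nonneg (Finset.range_mono h) fun j _ _ => by positivity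

/-- By linearity from the single-exponential formula at a = 1/(N+1) and a = β(j+1). -/
theorem integral_cothExpSum {β : ℝ} (hβ : 0 < β) (N : ℕ) (φ : 𝓢(ℝ, ℂ)) :
    ∫ x in Ioi (0 : ℝ), (cothExpSum β N x : ℂ) *
        (schwartzFourier φ x - schwartzFourier φ (-x)) =
      -2 * Complex.I * ∫ k in Ioi (0 : ℝ), (cothRatSum β N k : ℂ) * (φ k - φ (-k)) := by
  have he {a : ℝ} (ha : 0 < a) (ψ : 𝓢(ℝ, ℂ)) : IntegrableOn
      (fun x => (Real.exp (-(a * x)) : ℂ) * (ψ x - ψ (-x))) (Ioi 0) := by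
    refine integrableOn_mul_sub_neg (C := 1) (by fun_prop) (fun x hx => ?_) ψ
    rw [Complex.norm_real, Real.norm_of_nonneg (Real.exp_pos _).le]
    have h1 : Real.exp (-(a * x)) ≤ 1 := Real.exp_le_one_iff.2 (by nlinarith)
    have h2 : 0 < 1 / x := by positivity
    linarith
  have hr {a : ℝ} (ha : 0 < a) (ψ : 𝓢(ℝ, ℂ)) : IntegrableOn
      (fun k => ((k / (a ^ 2 + k ^ 2) : ℝ) : ℂ) * (ψ k - ψ (-k))) (Ioi 0) := by
    refine integrableOn_mul_sub_neg (C := 1) (by fun_prop) (fun k hk => ?_) ψ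
    rw [Complex.norm_real, Real.norm_of_nonneg (by positivity)]
    have h1 : k / (a ^ 2 + k ^ 2) ≤ 1 / k := by
      rw [div_le_div_iff₀ (by positivity) hk]
      nlinarith [sq_nonneg a]
    linarith
  have hN : 0 < 1 / ((N : ℝ) + 1) := by positivity
  have hj (j : ℕ) : 0 < β * ((j : ℝ) + 1) := by positivity
  simp only [cothExpSum, cothRatSum, Complex.ofReal_add, Complex.ofReal_mul, Complex.ofReal_sum,
    add_mul, mul_assoc ((2 : ℝ) : ℂ), Finset.sum_mul]
  rw [integral_add (he hN _) (((integrable_finsetSum _ fun j _ => he (hj j) _)).const_mul _),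
    integral_add (hr hN _) (((integrable_finsetSum _ fun j _ => hr (hj j) _)).const_mul _),
    integral_const_mul, integral_const_mul, integral_finsetSum _ fun j _ => he (hj j) _,
    integral_finsetSum _ fun j _ => hr (hj j) _, integral_exp_mul_schwartzFourier_sub_neg φ hN]
  simp only [integral_exp_mul_schwartzFourier_sub_neg φ (hj _), ← Finset.mul_sum]
  ring

theorem tendsto_integral_of_monotone_of_tendsto {T : ℕ → ℝ → ℝ} {F : ℝ → ℝ} {g : ℝ → ℂ}
    (hT : ∀ N, Measurable (T N)) (hg : Continuous g)
    (h0 : ∀ N x, 0 < x → 0 ≤ T N x) (hmono : ∀ x, 0 < x → Monotone fun N => T N x)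
    (hlim : ∀ x, 0 < x → Tendsto (fun N => T N x) atTop (𝓝 (F x)))
    (hF : IntegrableOn (fun x => (F x : ℂ) * g x) (Ioi 0)) :
    Tendsto (fun N => ∫ x in Ioi (0 : ℝ), (T N x : ℂ) * g x) atTop
      (𝓝 (∫ x in Ioi (0 : ℝ), (F x : ℂ) * g x)) := by
  refine tendsto_integral_of_dominated_convergence (fun x => ‖(F x : ℂ) * g x‖)
    (fun N => ((Complex.measurable_ofReal.comp (hT N)).mul hg.measurable).aestronglyMeasurable)
    hF.norm (fun N => (ae_restrict_iff' measurableSet_Ioi).2 (Eventually.of_forall fun x hx => ?_))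
    ((ae_restrict_iff' measurableSet_Ioi).2 (Eventually.of_forall fun x hx =>
      ((Complex.continuous_ofReal.tendsto _).comp (hlim x hx)).mul_const _))
  have h1 := (hmono x hx).ge_of_tendsto (hlim x hx) N
  have h2 := h0 N x hx
  rw [norm_mul, norm_mul, Complex.norm_real, Complex.norm_real, Real.norm_of_nonneg h2,
    Real.norm_of_nonneg (h2.trans h1)]
  gcongr

/-- Both sides are limits of the same sequence, the partial-sum identity; the constant is -2i · π/β
= 2π/(iβ). -/
theorem integral_coth_mul_schwartzFourier {β : ℝ} (hβ : 0 < β) (φ : 𝓢(ℝ, ℂ)) :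
    ∫ x in Ioi (0 : ℝ), ((coth (β / 2 * x) : ℝ) : ℂ) *
        (schwartzFourier φ x - schwartzFourier φ (-x)) =
      2 * Real.pi / (Complex.I * β) *
        ∫ k in Ioi (0 : ℝ), ((coth (Real.pi / β * k) : ℝ) : ℂ) * (φ k - φ (-k)) := by
  have hc (ψ : 𝓢(ℝ, ℂ)) : Continuous fun x => ψ x - ψ (-x) := by
    have := ψ.continuous
    fun_prop
  have hi := (integrableOn_coth_mul (div_pos Real.pi_pos hβ) φ).const_mul
    ((Real.pi / β : ℝ) : ℂ)
  simp only [← mul_assoc, ← Complex.ofReal_mul] at hi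
  have h1 := tendsto_integral_of_monotone_of_tendsto (T := cothExpSum β)
    (fun N => by unfold cothExpSum; fun_prop) (hc (schwartzFourier φ))
    (fun N x _ => cothExpSum_nonneg β N x) (fun x hx => monotone_cothExpSum β hx)
    (fun x hx => tendsto_cothExpSum hβ hx) (integrableOn_coth_mul (half_pos hβ) _)
  have h2 := tendsto_integral_of_monotone_of_tendsto (T := cothRatSum β)
    (fun N => by unfold cothRatSum; fun_prop) (hc φ)
    (fun N x hx => cothRatSum_nonneg β N hx) (fun x hx => monotone_cothRatSum β hx)
    (fun x hx => tendsto_cothRatSum hβ hx) hi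
  simp only [integral_cothExpSum hβ] at h1
  rw [tendsto_nhds_unique h1 (h2.const_mul _)]
  simp only [Complex.ofReal_mul, mul_assoc ((Real.pi / β : ℝ) : ℂ), integral_const_mul]
  have : (β : ℂ) ≠ 0 := by exact_mod_cast hβ.ne'
  push_cast
  field_simp
  rw [Complex.I_sq]
  ring

/-! ### Bose–Einstein, Fermi–Dirac and the limit β → ∞ -/

theorem exists_isPrincipalValue_boseEinstein {β : ℝ} (hβ : 0 < β) :
    ∃ B C : 𝓢'(ℝ, ℂ), IsPrincipalValue (boseEinstein β) B ∧
      IsPrincipalValue (fun k => ((coth (Real.pi / β * k) : ℝ) : ℂ)) C ∧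
      fourierDist B = ((Real.pi : ℂ) / (Complex.I * (β : ℂ))) • C -
        (Real.pi : ℂ) • TemperedDistribution.delta (0 : ℝ) := by
  obtain ⟨u, hu, hu'⟩ := exists_isPrincipalValue_coth (half_pos hβ)
  obtain ⟨C, hC, hC'⟩ := exists_isPrincipalValue_coth (div_pos Real.pi_pos hβ)
  have h1 : MemLp (fun _ : ℝ => (1 : ℂ)) ∞ volume := memLp_top_const 1
  refine ⟨(1 / 2 : ℂ) • u - (1 / 2 : ℂ) • regularDist _ h1, C, ?_, hC, ?_⟩
  · refine ((hu.const_smul _).sub ((isPrincipalValue_regularDist _ h1).const_smul _)).congr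
      fun x hx => ?_
    rw [show β / 2 * x = β * x / 2 by ring, coth_half _ (mul_ne_zero hβ.ne' hx), boseEinstein]
    push_cast
    ring
  · ext φ
    rw [fourierDist_apply]
    change (1 / 2 : ℂ) * u (schwartzFourier φ) - (1 / 2 : ℂ) * regularDist _ h1
      (schwartzFourier φ) = ((Real.pi : ℂ) / (Complex.I * (β : ℂ))) * C φ -
        (Real.pi : ℂ) * TemperedDistribution.delta (0 : ℝ) φ
    rw [hu', hC', regularDist_apply, TemperedDistribution.delta_apply,
      integral_coth_mul_schwartzFourier hβ]
    simp only [one_mul, integral_schwartzFourier]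
    ring

theorem fermiDirac_eq_boseEinstein_sub (β : ℝ) {x : ℝ} (h : β * x ≠ 0) :
    boseEinstein β x - 2 * boseEinstein (2 * β) x = fermiDirac β x := by
  have h1 : Real.exp (β * x) - 1 ≠ 0 := by simpa [sub_eq_zero] using h
  have h2 : Real.exp (2 * β * x) - 1 = (Real.exp (β * x) - 1) * (Real.exp (β * x) + 1) := by
    rw [show 2 * β * x = β * x + β * x by ring, Real.exp_add]
    ring
  have h3 : Real.exp (β * x) + 1 ≠ 0 := by positivity
  have h4 : 1 / (Real.exp (β * x) - 1) - 2 * (1 / (Real.exp (2 * β * x) - 1)) =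
      1 / (Real.exp (β * x) + 1) := by
    rw [h2]
    field_simp
    ring
  rw [boseEinstein, boseEinstein, fermiDirac, ← h4]
  push_cast
  ring

theorem fourierDist_fermiDiracDist {β : ℝ} (hβ : 0 < β) :
    ∃ S : 𝓢'(ℝ, ℂ),
      IsPrincipalValue (fun k : ℝ => ((1 / Real.sinh (Real.pi * k / β) : ℝ) : ℂ)) S ∧
      fourierDist (fermiDiracDist β) = (Real.pi : ℂ) • TemperedDistribution.delta (0 : ℝ) +
        (Complex.I * (Real.pi : ℂ) / (β : ℂ)) • S := by
  obtain ⟨B, C, hB, hC, hBC⟩ := exists_isPrincipalValue_boseEinstein hβ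
  obtain ⟨B', C', hB', hC', hBC'⟩ := exists_isPrincipalValue_boseEinstein
    (mul_pos two_pos hβ)
  -- A bounded function is its own principal value, so the pointwise identity off 0 and uniqueness
  -- identify the distributions.
  have hF : fermiDiracDist β = B - (2 : ℂ) • B' :=
    (isPrincipalValue_regularDist _ _).unique ((hB.sub (hB'.const_smul 2)).congr fun x hx =>
      fermiDirac_eq_boseEinstein_sub β (mul_ne_zero hβ.ne' hx))
  refine ⟨C' - C, (hC'.sub hC).congr fun k _ => ?_, ?_⟩
  · rw [one_div_sinh, ← Complex.ofReal_sub]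
    congr 3 <;> field_simp
  · have hlin : fourierDist (fermiDiracDist β) = fourierDist B - (2 : ℂ) • fourierDist B' := by
      rw [hF]
      simp only [fourierDist, map_sub, map_smul]
    have hβ' : (β : ℂ) ≠ 0 := by exact_mod_cast hβ.ne'
    have hc1 : (Real.pi : ℂ) / (Complex.I * (β : ℂ)) = -(Complex.I * Real.pi / β) := by
      field_simp
      rw [Complex.I_sq]
      ring
    have hc2 : (2 : ℂ) * (Real.pi / (Complex.I * ((2 * β : ℝ) : ℂ))) =
        -(Complex.I * Real.pi / β) := by
      rw [← hc1]
      push_cast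
      field_simp
    rw [hlin, hBC, hBC', smul_sub, smul_smul, hc1, hc2]
    module

/-- The origin is excluded because the value there is 1/2 for every β. -/
theorem tendsto_fermiDirac {x : ℝ} (hx : x ≠ 0) :
    Tendsto (fun β => fermiDirac β x) atTop (𝓝 (heaviside (-x))) := by
  rcases lt_or_gt_of_ne hx with h | h
  · have h1 : Tendsto (fun β : ℝ => Real.exp (β * x)) atTop (𝓝 0) :=
      Real.tendsto_exp_atBot.comp (tendsto_id.atTop_mul_const_of_neg h)
    have h2 : Tendsto (fun β : ℝ => 1 / (Real.exp (β * x) + 1)) atTop (𝓝 (1 / (0 + 1))) :=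
      tendsto_const_nhds.div (h1.add_const 1) (by norm_num)
    have h3 := (Complex.continuous_ofReal.tendsto _).comp h2
    simpa [heaviside, h, fermiDirac, Function.comp_def] using h3
  · have h1 : Tendsto (fun β : ℝ => Real.exp (β * x) + 1) atTop atTop :=
      tendsto_atTop_add_const_right _ _
        (Real.tendsto_exp_atTop.comp (tendsto_id.atTop_mul_const h))
    have h3 := (Complex.continuous_ofReal.tendsto _).comp h1.inv_tendsto_atTop
    simpa [heaviside, not_lt.2 h.le, fermiDirac, Function.comp_def] using h3

theorem tendsto_fourierDist_fermiDiracDist :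
    Tendsto (fun β : ℝ => fourierDist (fermiDiracDist β)) atTop
      (𝓝 (reflectDist (fourierDist heavisideDist))) := by
  rw [PointwiseConvergenceCLM.tendsto_iff_forall_tendsto]
  intro φ
  have h : reflectDist (fourierDist heavisideDist) φ =
      ∫ x, heaviside (-x) * schwartzFourier φ x := by
    rw [reflectDist_apply, fourierDist_apply, heavisideDist, regularDist_apply,
      ← integral_neg_eq_self]
    simp only [schwartzFourier_schwartzReflect, neg_neg]
  rw [h]
  simp only [fourierDist_apply, fermiDiracDist, regularDist_apply]
  have hφ := (schwartzFourier φ).integrable (μ := volume)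
  refine tendsto_integral_filter_of_dominated_convergence (fun x => ‖schwartzFourier φ x‖)
    (Eventually.of_forall fun β =>
      (memLp_fermiDirac β).aestronglyMeasurable.mul hφ.aestronglyMeasurable)
    (Eventually.of_forall fun β => Eventually.of_forall fun x => ?_) hφ.norm ?_
  · rw [norm_mul]
    refine mul_le_of_le_one_left (norm_nonneg _) ?_
    have h := Real.exp_pos (β * x)
    rw [fermiDirac, Complex.norm_real, Real.norm_of_nonneg (by positivity),
      div_le_one (by positivity)]
    linarith
  · filter_upwards [Measure.ae_ne volume (0 : ℝ)] with x hx
    exact (tendsto_fermiDirac hx).mul_const _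

end QuantumStatistics

theorem mainTheorem3 :
    (∀ β : ℝ, 0 < β → ∃ S : 𝓢'(ℝ, ℂ),
      QuantumStatistics.IsPrincipalValue
        (fun k : ℝ => ((1 / Real.sinh (Real.pi * k / β) : ℝ) : ℂ)) S ∧
      QuantumStatistics.fourierDist (QuantumStatistics.fermiDiracDist β) =
        (Real.pi : ℂ) • TemperedDistribution.delta (0 : ℝ) +
          (Complex.I * (Real.pi : ℂ) / (β : ℂ)) • S) ∧
    (∀ β : ℝ, 0 < β → ∃ B C : 𝓢'(ℝ, ℂ),
      QuantumStatistics.IsPrincipalValue (QuantumStatistics.boseEinstein β) B ∧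
      QuantumStatistics.IsPrincipalValue
        (fun k : ℝ => ((Real.cosh (Real.pi * k / β) / Real.sinh (Real.pi * k / β) : ℝ) : ℂ)) C ∧
      QuantumStatistics.fourierDist B =
        ((Real.pi : ℂ) / (Complex.I * (β : ℂ))) • C -
          (Real.pi : ℂ) • TemperedDistribution.delta (0 : ℝ)) ∧
    Tendsto (fun β : ℝ => QuantumStatistics.fourierDist (QuantumStatistics.fermiDiracDist β))
      atTop
      (𝓝 (QuantumStatistics.reflectDist
        (QuantumStatistics.fourierDist QuantumStatistics.heavisideDist))) := by
  refine ⟨fun β hβ => QuantumStatistics.fourierDist_fermiDiracDist hβ, fun β hβ => ?_,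
    QuantumStatistics.tendsto_fourierDist_fermiDiracDist⟩
  obtain ⟨B, C, hB, hC, h⟩ := QuantumStatistics.exists_isPrincipalValue_boseEinstein hβ
  refine ⟨B, C, hB, hC.congr fun k _ => ?_, h⟩
  rw [QuantumStatistics.coth, show Real.pi / β * k = Real.pi * k / β by ring]
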